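/- Let $X$ be a real Banach space, let $K$ be a nonempty compact Hausdorff space, and let $C(K)$ be the space of real-valued continuous functions on $K$ with the supremum norm. Write $B_{X^*}$ and $S_{X^*}$ for the closed unit ball and the unit sphere of $X^*$, and $\operatorname{Ext} C$ for the set of extreme points of a convex set $C$. For $x\in X$ with $\|x\|=1$, let $\mathfrak F(x)=\{x^*\in S_{X^*}:\ x^*(x)=1\}$ be the face of $B_{X^*}$ determined by $x$. Let $T\colon X\to C(K)$ be a U-embedding, that is, a linear isometry (not necessarily onto) such that for every $x^*\in S_{X^*}$ there is exactly one $\mu\in C(K)^*$ with $T^*\mu=x^*$ and $\|\mu\|=\|x^*\|$. Define $F_T\colon K\to X^*$ by $F_T(k)=T^*\delta_k$, i.e. $F_T(k)(x)=(Tx)(k)$. Let $A=F_T^{-1}(\operatorname{Ext}B_{X^*})\subset K$ be the U-core of $T$, and let $\operatorname{Ext}^+=F_T(A)$. Put $E=\overline{\operatorname{Ext}^+}^{w^*}$. Then $E=F_T(\overline{A})$, and $E$ is a proper U-suitable set. This means that $E$ is a $w^*$-closed subset of $B_{X^*}$ such that 1. $E\cap(-E)\cap S_{X^*}=\emptyset$;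 2. $E\cup(-E)=\overline{\operatorname{Ext}B_{X^*}}^{w^*}$; 3. for every $x\in X$ with $\|x\|=1$, $E\cap\mathfrak F(x)=E\cap\overline{\operatorname{Ext}\mathfrak F(x)}^{w^*}$. -/

import Mathlib

open scoped Pointwise

/-- `y` is a Hahn--Banach extension of `x` through `T`: `T* y = x` and `‖y‖ = ‖x‖`. -/
def IsHahnBanachExtension {X Y : Type*} [NormedAddCommGroup X] [NormedSpace ℝ X]
    [NormedAddCommGroup Y] [NormedSpace ℝ Y] (T : X →ₗᵢ[ℝ] Y)
    (x : StrongDual ℝ X) (y : StrongDual ℝ Y) : Prop :=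
  y.comp T.toContinuousLinearMap = x ∧ ‖y‖ = ‖x‖

/-- A linear isometry `T : X → Y` is a U-embedding if every norm-one functional on `X`
has a unique Hahn--Banach extension through `T`. -/
def IsUEmbedding {X Y : Type*} [NormedAddCommGroup X] [NormedSpace ℝ X]
    [NormedAddCommGroup Y] [NormedSpace ℝ Y] (T : X →ₗᵢ[ℝ] Y) : Prop :=
  ∀ x : StrongDual ℝ X, ‖x‖ = 1 → ∃! y : StrongDual ℝ Y, IsHahnBanachExtension T x y

/-- The closed unit ball of the dual of `X`, inside the dual with its weak-star topology. -/
def dualBall (X : Type*) [NormedAddCommGroup X] [NormedSpace ℝ X] : Set (WeakDual ℝ X) :=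
  {x | ‖WeakDual.toStrongDual x‖ ≤ 1}

/-- The unit sphere of the dual of `X`, inside the dual with its weak-star topology. -/
def dualSphere (X : Type*) [NormedAddCommGroup X] [NormedSpace ℝ X] : Set (WeakDual ℝ X) :=
  {x | ‖WeakDual.toStrongDual x‖ = 1}

/-- The face of the dual unit ball determined by `x`. -/
def dualFace {X : Type*} [NormedAddCommGroup X] [NormedSpace ℝ X] (x : X) :
    Set (WeakDual ℝ X) :=
  {φ | φ ∈ dualSphere X ∧ φ x = 1}

/-- The map `F_T = T* ∘ δ : K → X*`, that is, `F_T(k) = δ_k ∘ T`. -/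
noncomputable def dualMapOf {X K : Type*} [NormedAddCommGroup X] [NormedSpace ℝ X]
    [TopologicalSpace K] [CompactSpace K] (T : X →ₗᵢ[ℝ] C(K, ℝ)) (k : K) : WeakDual ℝ X :=
  StrongDual.toWeakDual ((ContinuousMap.evalCLM ℝ k).comp T.toContinuousLinearMap)

/-- The U-core of `T`: the preimage under `F_T` of the extreme points of the dual ball. -/
def uCore {X K : Type*} [NormedAddCommGroup X] [NormedSpace ℝ X]
    [TopologicalSpace K] [CompactSpace K] (T : X →ₗᵢ[ℝ] C(K, ℝ)) : Set K :=
  dualMapOf T ⁻¹' (dualBall X).extremePoints ℝ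

/-- `Ext⁺`, the image of the U-core under `F_T`. -/
def extPlus {X K : Type*} [NormedAddCommGroup X] [NormedSpace ℝ X]
    [TopologicalSpace K] [CompactSpace K] (T : X →ₗᵢ[ℝ] C(K, ℝ)) : Set (WeakDual ℝ X) :=
  dualMapOf T '' uCore T

/-- U-suitable sets. All closures are weak-star closures. -/
structure IsUSuitable {X : Type*} [NormedAddCommGroup X] [NormedSpace ℝ X]
    (E : Set (WeakDual ℝ X)) : Prop where
  isClosed : IsClosed E
  subset_ball : E ⊆ dualBall X
  inter_neg_inter_sphere : E ∩ (-E) ∩ dualSphere X = ∅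
  union_neg : E ∪ (-E) = closure ((dualBall X).extremePoints ℝ)

/-- Proper U-suitable sets. -/
structure IsProperUSuitable {X : Type*} [NormedAddCommGroup X] [NormedSpace ℝ X]
    (E : Set (WeakDual ℝ X)) : Prop extends IsUSuitable E where
  inter_face : ∀ x : X, ‖x‖ = 1 →
    E ∩ dualFace x = E ∩ closure ((dualFace x).extremePoints ℝ)

/-!
Each `δ_k` is an extreme point of the unit ball of `C(K)*`. Suppose `T* ν` has norm one with `ν`
extreme. If `T* ν` lies in an open segment of the dual ball of `X`, the endpoints have norm one, and
by uniqueness of extensions the same combination of their Hahn–Banach extensions is `ν`; extremality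
of `ν` then collapses the segment. Hence every `F_T(k)` of norm one is an extreme point of the dual
ball, so also of each face containing it, which gives condition 3. Condition 1 holds because
`F_T(k) = -F_T(l)` of norm one would force `δ_k = -δ_l`. Condition 2 comes from Milman's converse
to the Krein–Milman theorem: `F_T(K) ∪ -F_T(K)` is weak-star compact and norming, so it contains
all extreme points of the dual ball.
-/

section Milman

variable {E : Type*} [AddCommGroup E] [Module ℝ E] [TopologicalSpace E]
  [IsTopologicalAddGroup E] [ContinuousSMul ℝ E]

theorem isCompact_convexJoin {s t : Set E} (hs : IsCompact s) (ht : IsCompact t) :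
    IsCompact (convexJoin ℝ s t) := by
  have hcont : Continuous fun q : ℝ × E × E ↦ (1 - q.1) • q.2.1 + q.1 • q.2.2 := by fun_prop
  convert! (isCompact_Icc (a := (0 : ℝ)) (b := 1)).prod (hs.prod ht) |>.image hcont
  ext x
  simp only [mem_convexJoin, segment_eq_image, Set.mem_image, Set.mem_prod, Prod.exists]
  grind

variable [T2Space E]

theorem closedConvexHull_union_subset_convexJoin {s t : Set E} (hs : s.Nonempty) (ht : t.Nonempty)
    (hs' : IsCompact (closedConvexHull ℝ s)) (ht' : IsCompact (closedConvexHull ℝ t)) :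
    closedConvexHull ℝ (s ∪ t) ⊆ convexJoin ℝ (closedConvexHull ℝ s) (closedConvexHull ℝ t) :=
  closedConvexHull_min
    (Set.union_subset
      (subset_closedConvexHull.trans
        (subset_convexJoin_left (ht.mono subset_closedConvexHull)))
      (subset_closedConvexHull.trans
        (subset_convexJoin_right (hs.mono subset_closedConvexHull))))
    (convex_closedConvexHull.convexJoin convex_closedConvexHull)
    (isCompact_convexJoin hs' ht').isClosed

theorem mem_closedConvexHull_or_of_mem_extremePoints {C s t : Set E} (hC : IsCompact C)
    (hconv : Convex ℝ C) (hs : s ⊆ C) (ht : t ⊆ C) {p : E} (hp : p ∈ C.extremePoints ℝ)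
    (hpst : p ∈ closedConvexHull ℝ (s ∪ t)) :
    p ∈ closedConvexHull ℝ s ∨ p ∈ closedConvexHull ℝ t := by
  rcases s.eq_empty_or_nonempty with rfl | hs₀
  · exact .inr (by rwa [Set.empty_union] at hpst)
  rcases t.eq_empty_or_nonempty with rfl | ht₀
  · exact .inl (by rwa [Set.union_empty] at hpst)
  have hull_subset {u : Set E} (hu : u ⊆ C) : closedConvexHull ℝ u ⊆ C :=
    closedConvexHull_min hu hconv hC.isClosed
  have hull_compact {u : Set E} (hu : u ⊆ C) : IsCompact (closedConvexHull ℝ u) :=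
    hC.of_isClosed_subset isClosed_closedConvexHull (hull_subset hu)
  obtain ⟨a, ha, b, hb, hab⟩ := mem_convexJoin.1
    (closedConvexHull_union_subset_convexJoin hs₀ ht₀ (hull_compact hs) (hull_compact ht) hpst)
  rcases (mem_extremePoints_iff_forall_segment.1 hp).2 a (hull_subset hs ha) b
    (hull_subset ht hb) hab with rfl | rfl
  exacts [.inl ha, .inr hb]

theorem extremePoints_closedConvexHull_subset_closure [LocallyConvexSpace ℝ E] {s : Set E}
    (hs : IsCompact (closedConvexHull ℝ s)) :
    (closedConvexHull ℝ s).extremePoints ℝ ⊆ closure s := by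
  intro p hp
  by_contra hps
  have hcompact : IsCompact (closure s) :=
    hs.of_isClosed_subset isClosed_closure closure_subset_closedConvexHull
  have hsub (u : Set E) : u ∩ s ⊆ closedConvexHull ℝ s :=
    Set.inter_subset_right.trans subset_closedConvexHull
  -- `closure s` is covered by closed half-spaces that miss `p`; finitely many of them suffice.
  have hlocal : ∀ x ∈ closure s, ∃ u ∈ nhdsWithin x (closure s),
      p ∉ closedConvexHull ℝ (u ∩ s) := by
    intro x hx
    obtain ⟨f, hf⟩ := geometric_hahn_banach_point_point (ne_of_mem_of_not_mem hx hps)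
    obtain ⟨c, hxc, hcp⟩ := exists_between hf
    refine ⟨{y | f y ≤ c}, mem_nhdsWithin_of_mem_nhds ?_, fun hpu ↦ hcp.not_ge ?_⟩
    · exact f.continuous.continuousAt.eventually_le_const hxc
    · exact closedConvexHull_min Set.inter_subset_left (convex_halfSpace_le f.isLinear c)
        (isClosed_le f.continuous continuous_const) hpu
  have hglobal : p ∉ closedConvexHull ℝ (closure s ∩ s) :=
    hcompact.induction_on (p := fun u ↦ p ∉ closedConvexHull ℝ (u ∩ s))
      (by simp [closedConvexHull_eq_closure_convexHull])
      (fun u v huv hv hu ↦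
        hv ((closedConvexHull ℝ).monotone (Set.inter_subset_inter_left s huv) hu))
      (fun u v hu hv huv ↦ by
        rw [Set.union_inter_distrib_right] at huv
        exact (mem_closedConvexHull_or_of_mem_extremePoints hs convex_closedConvexHull
          (hsub u) (hsub v) hp huv).elim hu hv)
      hlocal
  rw [Set.inter_eq_self_of_subset_right subset_closure] at hglobal
  exact hglobal hp.1

end Milman

section DualBall

variable {X : Type*} [NormedAddCommGroup X] [NormedSpace ℝ X]

theorem dualBall_eq_preimage_closedBall :
    dualBall X = WeakDual.toStrongDual ⁻¹' Metric.closedBall (0 : StrongDual ℝ X) 1 := by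
  ext φ
  simp [dualBall]

theorem isCompact_dualBall : IsCompact (dualBall X) :=
  dualBall_eq_preimage_closedBall (X := X) ▸ WeakDual.isCompact_closedBall 0 1

theorem convex_dualBall : Convex ℝ (dualBall X) :=
  dualBall_eq_preimage_closedBall (X := X) ▸
    (convex_closedBall 0 1).linear_preimage (WeakDual.toStrongDual (𝕜 := ℝ) (E := X)).toLinearMap

theorem neg_dualBall : -dualBall X = dualBall X := by
  ext φ
  simp [dualBall]

theorem neg_extremePoints_dualBall :
    -(dualBall X).extremePoints ℝ = (dualBall X).extremePoints ℝ := by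
  have h := image_extremePoints (𝕜 := ℝ) (LinearEquiv.neg ℝ (M := WeakDual ℝ X)) (dualBall X)
  simpa [Set.image_neg_eq_neg, neg_dualBall] using h

instance instLocallyConvexSpaceWeakDual : LocallyConvexSpace ℝ (WeakDual ℝ X) :=
  (WeakDual.withSeminorms ℝ X).toLocallyConvexSpace

theorem apply_le_norm_of_mem_dualBall {φ : WeakDual ℝ X} (hφ : φ ∈ dualBall X) (x : X) :
    φ x ≤ ‖x‖ := by
  simpa using (le_abs_self _).trans ((WeakDual.toStrongDual φ).le_of_opNorm_le hφ x)

theorem dualFace_eq_dualBall_inter {x : X} (hx : ‖x‖ = 1) :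
    dualFace x = dualBall X ∩ {φ | φ x = 1} := by
  ext φ
  refine ⟨fun hφ ↦ ⟨hφ.1.le, hφ.2⟩, fun ⟨hφ, hφx⟩ ↦ ⟨le_antisymm hφ ?_, hφx⟩⟩
  have hφx' : WeakDual.toStrongDual φ x = 1 := hφx
  simpa [hx, hφx'] using (WeakDual.toStrongDual φ).le_opNorm x

theorem isClosed_dualFace {x : X} (hx : ‖x‖ = 1) : IsClosed (dualFace x) :=
  dualFace_eq_dualBall_inter hx ▸ isCompact_dualBall.isClosed.inter
    (isClosed_eq (WeakDual.eval_continuous x) continuous_const)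

theorem closedConvexHull_eq_dualBall {S : Set (WeakDual ℝ X)} (hS : S ⊆ dualBall X)
    (hnorming : ∀ (x : X) (c : ℝ), (∀ φ ∈ S, φ x ≤ c) → ‖x‖ ≤ c) :
    closedConvexHull ℝ S = dualBall X := by
  refine (closedConvexHull_min hS convex_dualBall isCompact_dualBall.isClosed).antisymm ?_
  intro φ hφ
  by_contra hφS
  obtain ⟨f, c, hfc, hcφ⟩ := geometric_hahn_banach_closed_point convex_closedConvexHull
    isClosed_closedConvexHull hφS
  obtain ⟨x, rfl⟩ := LinearMap.dualEmbedding_surjective (topDualPairing ℝ X) f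
  have hxc : ‖x‖ ≤ c := hnorming x c fun ψ hψ ↦ (hfc ψ (subset_closedConvexHull hψ)).le
  exact ((apply_le_norm_of_mem_dualBall hφ x).trans hxc).not_gt hcφ

theorem isExtreme_setOf_apply_eq_norm (x : X) :
    IsExtreme ℝ (dualBall X) {φ ∈ dualBall X | φ x = ‖x‖} := by
  refine ⟨Set.sep_subset _ _, ?_⟩
  rintro φ hφ ψ hψ _ ⟨-, hx⟩ ⟨a, b, ha, hb, hab, rfl⟩
  have hφx : φ x ≤ ‖x‖ := apply_le_norm_of_mem_dualBall hφ x
  have hψx : ψ x ≤ ‖x‖ := apply_le_norm_of_mem_dualBall hψ x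
  refine ⟨hφ, hφx.eq_of_not_lt fun hlt ↦ hx.not_lt ?_⟩
  calc a * φ x + b * ψ x < a * ‖x‖ + b * ‖x‖ :=
        add_lt_add_of_lt_of_le (by gcongr) (by gcongr)
    _ = ‖x‖ := by rw [← add_mul, hab, one_mul]

end DualBall

section Evaluation

variable {K : Type*} [TopologicalSpace K] [CompactSpace K]

theorem norm_evalCLM_le_one (k : K) :
    ‖(ContinuousMap.evalCLM ℝ k : StrongDual ℝ C(K, ℝ))‖ ≤ 1 :=
  ContinuousLinearMap.opNorm_le_bound _ zero_le_one fun f ↦ by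
    simpa using f.norm_coe_le_norm k

theorem toWeakDual_evalCLM_mem_extremePoints_dualBall (k : K) :
    StrongDual.toWeakDual (ContinuousMap.evalCLM ℝ k) ∈
      (dualBall C(K, ℝ)).extremePoints ℝ := by
  refine ⟨norm_evalCLM_le_one k, fun μ hμ ν hν hk ↦ ?_⟩
  have apply_eq_of_peak (h : C(K, ℝ)) (hh : ∀ l, |h l| ≤ h k) : μ h = h k := by
    have hnorm : h k = ‖h‖ := le_antisymm ((le_abs_self _).trans (h.norm_coe_le_norm k))
      ((ContinuousMap.norm_le _ ((abs_nonneg _).trans (hh k))).2 hh)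
    have hμh := (isExtreme_setOf_apply_eq_norm h).left_mem_of_mem_openSegment hμ hν
      ⟨norm_evalCLM_le_one k, hnorm⟩ hk
    exact hμh.2.trans hnorm.symm
  refine DFunLike.ext _ _ fun f ↦ ?_
  -- The constant `3 * ‖f‖` makes `g` and `f + g` nonnegative; both are then largest at `k`.
  let g : C(K, ℝ) := ContinuousMap.const K (3 * ‖f‖) - |f - ContinuousMap.const K (f k)|
  have hg (l : K) : g l = 3 * ‖f‖ - |f l - f k| := rfl
  have hf (l : K) : |f l| ≤ ‖f‖ := f.norm_coe_le_norm l
  have hμg : μ g = g k := apply_eq_of_peak g fun l ↦ by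
    rw [hg, hg]
    grind
  have hμfg : μ (f + g) = (f + g) k := apply_eq_of_peak (f + g) fun l ↦ by
    rw [ContinuousMap.add_apply, ContinuousMap.add_apply, hg, hg]
    grind
  rw [map_add, hμg, ContinuousMap.add_apply] at hμfg
  simpa using hμfg

end Evaluation

section UEmbedding

variable {X Y : Type*} [NormedAddCommGroup X] [NormedSpace ℝ X] [NormedAddCommGroup Y]
  [NormedSpace ℝ Y]

theorem norm_comp_toContinuousLinearMap_le (T : X →ₗᵢ[ℝ] Y) (ν : StrongDual ℝ Y) :
    ‖ν.comp T.toContinuousLinearMap‖ ≤ ‖ν‖ :=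
  ContinuousLinearMap.opNorm_le_bound _ (norm_nonneg ν) fun x ↦ by
    simpa using ν.le_opNorm (T x)

theorem IsUEmbedding.eq_of_comp_eq {T : X →ₗᵢ[ℝ] Y} (hT : IsUEmbedding T)
    {μ ν : StrongDual ℝ Y} (hμ : ‖μ‖ ≤ 1) (hν : ‖ν‖ ≤ 1)
    (hnorm : ‖μ.comp T.toContinuousLinearMap‖ = 1)
    (h : μ.comp T.toContinuousLinearMap = ν.comp T.toContinuousLinearMap) : μ = ν := by
  have norm_eq {ρ : StrongDual ℝ Y} (hρ : ‖ρ‖ ≤ 1) (hρT : ‖ρ.comp T.toContinuousLinearMap‖ = 1) :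
      ‖ρ‖ = 1 :=
    hρ.antisymm (hρT ▸ norm_comp_toContinuousLinearMap_le T ρ)
  exact (hT _ hnorm).unique ⟨rfl, by rw [norm_eq hμ hnorm, hnorm]⟩
    ⟨h.symm, by rw [norm_eq hν (h ▸ hnorm), hnorm]⟩

theorem IsUEmbedding.toWeakDual_comp_mem_extremePoints_dualBall {T : X →ₗᵢ[ℝ] Y}
    (hT : IsUEmbedding T) {ν : StrongDual ℝ Y}
    (hν : StrongDual.toWeakDual ν ∈ (dualBall Y).extremePoints ℝ)
    (hnorm : ‖ν.comp T.toContinuousLinearMap‖ = 1) :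
    StrongDual.toWeakDual (ν.comp T.toContinuousLinearMap) ∈ (dualBall X).extremePoints ℝ := by
  refine ⟨hnorm.le, ?_⟩
  rintro φ₁ hφ₁ φ₂ hφ₂ ⟨a, b, ha, hb, hab, hφ⟩
  replace hφ : a • φ₁.toStrongDual + b • φ₂.toStrongDual = ν.comp T.toContinuousLinearMap := hφ
  have one_le : 1 ≤ a * ‖φ₁.toStrongDual‖ + b * ‖φ₂.toStrongDual‖ := by
    simpa [norm_smul, abs_of_pos ha, abs_of_pos hb, hφ, hnorm]
      using norm_add_le (a • φ₁.toStrongDual) (b • φ₂.toStrongDual)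
  have hφ₁_norm : ‖φ₁.toStrongDual‖ = 1 := le_antisymm hφ₁ (by nlinarith [hφ₂.out])
  have hφ₂_norm : ‖φ₂.toStrongDual‖ = 1 := le_antisymm hφ₂ (by nlinarith [hφ₁.out])
  obtain ⟨ν₁, ⟨hν₁T, hν₁⟩, -⟩ := hT _ hφ₁_norm
  obtain ⟨ν₂, ⟨hν₂T, hν₂⟩, -⟩ := hT _ hφ₂_norm
  have hν₁_ball : StrongDual.toWeakDual ν₁ ∈ dualBall Y := (hν₁.trans hφ₁_norm).le
  have hν₂_ball : StrongDual.toWeakDual ν₂ ∈ dualBall Y := (hν₂.trans hφ₂_norm).le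
  have hcomp : ν.comp T.toContinuousLinearMap = (a • ν₁ + b • ν₂).comp T.toContinuousLinearMap := by
    rw [ContinuousLinearMap.add_comp, ContinuousLinearMap.smul_comp,
      ContinuousLinearMap.smul_comp, hν₁T, hν₂T, hφ]
  have hcombination : ν = a • ν₁ + b • ν₂ :=
    hT.eq_of_comp_eq hν.1 (convex_dualBall hν₁_ball hν₂_ball ha.le hb.le hab) hnorm hcomp
  have hν₁_eq : ν₁ = ν := hν.2 hν₁_ball hν₂_ball ⟨a, b, ha, hb, hab, hcombination.symm⟩
  exact hν₁_eq ▸ hν₁T.symm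

end UEmbedding

section DualMap

variable {X K : Type*} [NormedAddCommGroup X] [NormedSpace ℝ X] [TopologicalSpace K]
  [CompactSpace K]

theorem continuous_dualMapOf (T : X →ₗᵢ[ℝ] C(K, ℝ)) : Continuous (dualMapOf T) :=
  WeakDual.continuous_of_continuous_eval fun x ↦ (T x).continuous

theorem dualMapOf_mem_dualBall (T : X →ₗᵢ[ℝ] C(K, ℝ)) (k : K) : dualMapOf T k ∈ dualBall X :=
  (norm_comp_toContinuousLinearMap_le T _).trans (norm_evalCLM_le_one k)

theorem closedConvexHull_range_dualMapOf [Nonempty K] (T : X →ₗᵢ[ℝ] C(K, ℝ)) :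
    closedConvexHull ℝ (Set.range (dualMapOf T) ∪ -Set.range (dualMapOf T)) = dualBall X := by
  have hrange : Set.range (dualMapOf T) ⊆ dualBall X :=
    Set.range_subset_iff.2 (dualMapOf_mem_dualBall T)
  refine closedConvexHull_eq_dualBall (Set.union_subset hrange ?_) fun x c hc ↦ ?_
  · rwa [← neg_dualBall, Set.neg_subset_neg]
  · rw [← T.norm_map, ContinuousMap.norm_le_of_nonempty]
    intro k
    rw [Real.norm_eq_abs, abs_le']
    exact ⟨hc _ (.inl ⟨k, rfl⟩), hc (-dualMapOf T k) (.inr (by simp))⟩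

theorem extremePoints_dualBall_subset_range_dualMapOf [Nonempty K] (T : X →ₗᵢ[ℝ] C(K, ℝ)) :
    (dualBall X).extremePoints ℝ ⊆ Set.range (dualMapOf T) ∪ -Set.range (dualMapOf T) := by
  have hclosed : IsClosed (Set.range (dualMapOf T)) :=
    (isCompact_range (continuous_dualMapOf T)).isClosed
  have hhull := closedConvexHull_range_dualMapOf T
  have h := extremePoints_closedConvexHull_subset_closure (hhull ▸ isCompact_dualBall)
  rwa [hhull, (hclosed.union hclosed.neg).closure_eq] at h

theorem extPlus_eq_extremePoints_inter_range (T : X →ₗᵢ[ℝ] C(K, ℝ)) :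
    extPlus T = (dualBall X).extremePoints ℝ ∩ Set.range (dualMapOf T) :=
  Set.image_preimage_eq_inter_range

theorem extPlus_union_neg [Nonempty K] (T : X →ₗᵢ[ℝ] C(K, ℝ)) :
    extPlus T ∪ -extPlus T = (dualBall X).extremePoints ℝ := by
  rw [extPlus_eq_extremePoints_inter_range, Set.inter_neg, neg_extremePoints_dualBall,
    ← Set.inter_union_distrib_left]
  exact Set.inter_eq_left.2 (extremePoints_dualBall_subset_range_dualMapOf T)

theorem image_closure_uCore (T : X →ₗᵢ[ℝ] C(K, ℝ)) :
    dualMapOf T '' closure (uCore T) = closure (extPlus T) :=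
  image_closure_of_isCompact isClosed_closure.isCompact (continuous_dualMapOf T).continuousOn

theorem closure_extPlus_subset_range (T : X →ₗᵢ[ℝ] C(K, ℝ)) :
    closure (extPlus T) ⊆ Set.range (dualMapOf T) :=
  image_closure_uCore T ▸ Set.image_subset_range _ _

theorem IsUEmbedding.dualMapOf_ne_neg_dualMapOf {T : X →ₗᵢ[ℝ] C(K, ℝ)} (hT : IsUEmbedding T)
    {k : K} (hk : dualMapOf T k ∈ dualSphere X) (l : K) : dualMapOf T k ≠ -dualMapOf T l := by
  intro h
  have heval : (ContinuousMap.evalCLM ℝ k : StrongDual ℝ C(K, ℝ)) = -ContinuousMap.evalCLM ℝ l :=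
    hT.eq_of_comp_eq (norm_evalCLM_le_one k) (by simpa using norm_evalCLM_le_one l) hk h
  have hone : (1 : ℝ) = -1 := DFunLike.congr_fun heval 1
  norm_num at hone

theorem IsUEmbedding.dualMapOf_mem_extremePoints_dualBall {T : X →ₗᵢ[ℝ] C(K, ℝ)}
    (hT : IsUEmbedding T) {k : K} (hk : dualMapOf T k ∈ dualSphere X) :
    dualMapOf T k ∈ (dualBall X).extremePoints ℝ :=
  hT.toWeakDual_comp_mem_extremePoints_dualBall
    (toWeakDual_evalCLM_mem_extremePoints_dualBall k) hk

theorem IsUEmbedding.range_inter_dualFace_subset_extremePoints {T : X →ₗᵢ[ℝ] C(K, ℝ)}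
    (hT : IsUEmbedding T) (x : X) :
    Set.range (dualMapOf T) ∩ dualFace x ⊆ (dualFace x).extremePoints ℝ := by
  rintro _ ⟨⟨k, rfl⟩, hk⟩
  exact inter_extremePoints_subset_extremePoints_of_subset
    (fun φ hφ ↦ hφ.1.le) ⟨hk, hT.dualMapOf_mem_extremePoints_dualBall hk.1⟩

end DualMap

theorem mainTheorem6_general {X K : Type*} [NormedAddCommGroup X] [NormedSpace ℝ X]
    [TopologicalSpace K] [CompactSpace K] [Nonempty K]
    (T : X →ₗᵢ[ℝ] C(K, ℝ)) (hT : IsUEmbedding T) :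
    dualMapOf T '' closure (uCore T) = closure (extPlus T) ∧
      IsProperUSuitable (closure (extPlus T)) := by
  have hrange := closure_extPlus_subset_range T
  refine ⟨image_closure_uCore T, ⟨isClosed_closure, ?_, ?_, ?_⟩, fun x hx ↦ ?_⟩
  · exact hrange.trans (Set.range_subset_iff.2 (dualMapOf_mem_dualBall T))
  · rw [Set.eq_empty_iff_forall_notMem]
    rintro φ ⟨⟨hφ, hφneg⟩, hφnorm⟩
    obtain ⟨k, rfl⟩ := hrange hφ
    obtain ⟨l, hl⟩ := hrange hφneg
    exact hT.dualMapOf_ne_neg_dualMapOf hφnorm l (by rw [hl, neg_neg])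
  · rw [neg_closure, ← closure_union, extPlus_union_neg]
  · refine Set.Subset.antisymm (fun φ hφ ↦ ⟨hφ.1, subset_closure ?_⟩)
      (Set.inter_subset_inter_right _ (closure_minimal extremePoints_subset (isClosed_dualFace hx)))
    exact hT.range_inter_dualFace_subset_extremePoints x ⟨hrange hφ.1, hφ.2⟩

theorem mainTheorem6 {X K : Type*} [NormedAddCommGroup X] [NormedSpace ℝ X] [CompleteSpace X]
    [TopologicalSpace K] [CompactSpace K] [T2Space K] [Nonempty K]
    (T : X →ₗᵢ[ℝ] C(K, ℝ)) (hT : IsUEmbedding T) :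
    dualMapOf T '' closure (uCore T) = closure (extPlus T) ∧
      IsProperUSuitable (closure (extPlus T)) :=
  mainTheorem6_general T hT
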